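/- Let $p$ be a prime, let $T$ be the $p$-adic rooted tree, whose vertices are the finite words over $X=\{1,\dots,p\}$, the words $ux$ ($x\in X$) being the vertices hanging from $u$, and let $L_n$ be the set of words of length $n$. For $g\in\operatorname{Aut}T$ and a vertex $u$, the section $g_u\in\operatorname{Aut}T$ is defined by $g(uv)=g(u)\,g_u(v)$ for all words $v$. Let $a\in\operatorname{Aut}T$ be the rooted automorphism corresponding to the cycle $(1\,2\,\dots\,p)$, i.e. $a(xw)=\sigma(x)w$ with $\sigma=(1\,2\,\dots\,p)$. Given a non-zero vector $e=(e_1,\dots,e_{p-1})\in(\mathbb{Z}/p\mathbb{Z})^{p-1}$, let $b\in\operatorname{Aut}T$ be the automorphism that fixes every vertex of $L_1$ and has sections $a^{e_1},\dots,a^{e_{p-1}},b$ at the vertices $1,\dots,p-1,p$, respectively. The group $G=\langle a,b\rangle$ is the GGS-group with defining vector $e$. **Proposition.** Let $G$ be the GGS-group with defining vector $e$, where $p$ is a prime and $e\neq 0$, and suppose that $e_1+\dots+e_{p-1}\equiv 0\pmod p$. Then $G$ is super strongly fractal: $G$ is self-similar (that is, $g_u\in G$ for all $g\in G$ and all vertices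 $u$), and for every $n\geq 0$ and every $u\in L_n$, $$\{\,g_u \mid g\in \operatorname{st}_G(L_n)\,\}=G,$$ where $\operatorname{st}_G(L_n)$ is the subgroup of the elements of $G$ that fix every vertex of $L_n$. -/

import Mathlib

/-- The tree of words over `X` (the free monoid on `X`, rooted at the empty word):
`IsChild u v` says that `v = u x` for a letter `x`, i.e. that `v` hangs directly from `u`. -/
def IsChild {X : Type*} (u v : List X) : Prop := ∃ x : X, v = u ++ [x]

/-- The automorphism group of the tree of words over `X`: the bijections of the set of vertices
that preserve (in both directions) the incidence relation. It is a group under composition,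
`(f * g) u = f (g u)`. -/
abbrev TreeAut (X : Type*) : Type _ := (IsChild (X := X)) ≃r (IsChild (X := X))

namespace TreeAut

variable {X : Type*}

theorem apply_child (g : TreeAut X) (u : List X) (x : X) :
    ∃ y, g (u ++ [x]) = g u ++ [y] :=
  g.map_rel_iff.mpr ⟨x, rfl⟩

theorem apply_append (g : TreeAut X) (u v : List X) :
    ∃ w, w.length = v.length ∧ g (u ++ v) = g u ++ w := by
  induction v using List.reverseRecOn with
  | nil => exact ⟨[], rfl, by simp⟩
  | append_singleton v x ih =>
    obtain ⟨w, hw, h⟩ := ih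
    obtain ⟨y, hy⟩ := apply_child g (u ++ v) x
    refine ⟨w ++ [y], by simp [hw], ?_⟩
    rw [← List.append_assoc, hy, h, List.append_assoc]

theorem apply_nil (g : TreeAut X) : g [] = [] := by
  obtain ⟨w, _, h⟩ := apply_append g [] (g.symm [])
  simp only [List.nil_append, RelIso.apply_symm_apply] at h
  exact (List.append_eq_nil_iff.mp h.symm).1

theorem length_apply (g : TreeAut X) (u : List X) : (g u).length = u.length := by
  obtain ⟨w, hw, h⟩ := apply_append g [] u
  simp only [List.nil_append, apply_nil] at h
  rw [h, hw]

/-- The map underlying the section: delete from `g (u v)` its initial part `g u`. -/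
def sectionFun (g : TreeAut X) (u v : List X) : List X := (g (u ++ v)).drop u.length

theorem apply_append_eq (g : TreeAut X) (u v : List X) :
    g (u ++ v) = g u ++ sectionFun g u v := by
  obtain ⟨w, _, h⟩ := apply_append g u v
  rw [sectionFun, h, ← length_apply g u, List.drop_left]

theorem sectionFun_symm_left (g : TreeAut X) (u v : List X) :
    sectionFun g.symm (g u) (sectionFun g u v) = v := by
  have h := apply_append_eq g.symm (g u) (sectionFun g u v)
  rw [← apply_append_eq, RelIso.symm_apply_apply, RelIso.symm_apply_apply] at h
  exact (List.append_cancel_left h).symm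

theorem sectionFun_symm_right (g : TreeAut X) (u v : List X) :
    sectionFun g u (sectionFun g.symm (g u) v) = v := by
  have h := sectionFun_symm_left g.symm (g u) v
  rwa [RelIso.symm_apply_apply, RelIso.symm_symm] at h

/-- The section `g_u` of `g` at the vertex `u`, that is, the automorphism with
`g (u v) = g(u) g_u(v)` for all `v` (see `apply_append_sectionAt`). -/
def sectionAt (g : TreeAut X) (u : List X) : TreeAut X where
  toFun := sectionFun g u
  invFun := sectionFun g.symm (g u)
  left_inv := sectionFun_symm_left g u
  right_inv := sectionFun_symm_right g u
  map_rel_iff' := by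
    intro v w
    have key : ∀ s t r : List X, IsChild (s ++ t) (s ++ r) ↔ IsChild t r := by
      intro s t r
      simp [IsChild]
    change IsChild (sectionFun g u v) (sectionFun g u w) ↔ IsChild v w
    rw [← key (g u), ← apply_append_eq, ← apply_append_eq, g.map_rel_iff, key]

theorem apply_append_sectionAt (g : TreeAut X) (u v : List X) :
    g (u ++ v) = g u ++ g.sectionAt u v :=
  apply_append_eq g u v

/-- The stabilizer `st(L_n)` of the `n`-th level: all words of length `n` are fixed. -/
def levelStabilizer (X : Type*) (n : ℕ) : Subgroup (TreeAut X) where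
  carrier := {g | ∀ u : List X, u.length = n → g u = u}
  one_mem' := fun _ _ => rfl
  mul_mem' := by
    intro f g hf hg u hu
    rw [RelIso.mul_apply, hg u hu, hf u hu]
  inv_mem' := by
    intro g hg u hu
    have h := congrArg (⇑g⁻¹) (hg u hu)
    rw [RelIso.inv_apply_self] at h
    exact h.symm

/-- A subgroup `G` of the automorphism group of the tree is self-similar if it contains
all sections of its elements. -/
def IsSelfSimilar (G : Subgroup (TreeAut X)) : Prop :=
  ∀ g ∈ G, ∀ u : List X, g.sectionAt u ∈ G

/-- A self-similar group `G` is super strongly fractal if `ψ_u(st_G(L_n)) = G` for every `n`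
and every vertex `u` of the `n`-th level, where `st_G(L_n) = G ∩ st(L_n)` and `ψ_u(g) = g_u`. -/
def IsSuperStronglyFractal (G : Subgroup (TreeAut X)) : Prop :=
  IsSelfSimilar G ∧
    ∀ (n : ℕ) (u : List X), u.length = n →
      (fun g : TreeAut X => g.sectionAt u) '' ((G ⊓ levelStabilizer X n : Subgroup (TreeAut X)) :
        Set (TreeAut X)) = (G : Set (TreeAut X))

theorem isChild_cons_cons (x y : X) (v w : List X) :
    IsChild (x :: v) (y :: w) ↔ x = y ∧ IsChild v w := by
  simp only [IsChild, List.cons_append, List.cons.injEq, exists_and_left]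
  exact and_congr_left fun _ => eq_comm

theorem not_isChild_nil (v : List X) : ¬ IsChild v [] := by
  simp [IsChild]

/-- The map `x w ↦ σ(x) w` on words. -/
def rootedFun (σ : Equiv.Perm X) : List X → List X
  | [] => []
  | x :: w => σ x :: w

/-- The rooted automorphism corresponding to the permutation `σ` of `X`: it permutes
the subtrees hanging from the root as `σ` does, and has trivial sections there. -/
def rooted (σ : Equiv.Perm X) : TreeAut X where
  toFun := rootedFun σ
  invFun := rootedFun σ.symm
  left_inv := by rintro (_ | ⟨x, w⟩) <;> simp [rootedFun]
  right_inv := by rintro (_ | ⟨x, w⟩) <;> simp [rootedFun]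
  map_rel_iff' := by
    rintro (_ | ⟨x, v⟩) (_ | ⟨y, w⟩)
    · rfl
    · simp [rootedFun, IsChild]
    · simp [rootedFun, IsChild]
    · simp [rootedFun, isChild_cons_cons]

/-- The generator `a` of the GGS-groups over the `d`-adic tree: the rooted automorphism
corresponding to the cycle `(1 … d)`. The letters `1, …, d` are the elements `0, …, d - 1`
of `Fin d`, in this order. -/
def ggsA (d : ℕ) : TreeAut (Fin d) := rooted (finRotate d)

/-- The map on words underlying the generator `b`: it fixes the first letter and acts on the rest
of the word by `a ^ {e_i}` below the `i`-th letter for `i = 1, …, d - 1`, and by `b` itself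
below the last letter. (As `a ^ d = 1`, the power may be computed with the representative
`(e i).val` of the residue class `e i`.) -/
def ggsBFun {d : ℕ} (e : Fin (d - 1) → ZMod d) : List (Fin d) → List (Fin d)
  | [] => []
  | x :: w =>
    if h : x.val < d - 1 then x :: (ggsA d ^ (e ⟨x.val, h⟩).val) w
    else x :: ggsBFun e w

/-- The inverse of `ggsBFun e`. -/
def ggsBInvFun {d : ℕ} (e : Fin (d - 1) → ZMod d) : List (Fin d) → List (Fin d)
  | [] => []
  | x :: w =>
    if h : x.val < d - 1 then x :: (ggsA d ^ (e ⟨x.val, h⟩).val)⁻¹ w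
    else x :: ggsBInvFun e w

/-- The generator `b` of the GGS-group with defining vector `e = (e_1, …, e_{d-1})`: the
automorphism in `st(L_1)` with `ψ(b) = (a^{e_1}, …, a^{e_{d-1}}, b)`. -/
def ggsB {d : ℕ} (e : Fin (d - 1) → ZMod d) : TreeAut (Fin d) where
  toFun := ggsBFun e
  invFun := ggsBInvFun e
  left_inv := by
    intro v
    induction v with
    | nil => rfl
    | cons x w ih =>
      by_cases h : x.val < d - 1
      · simp only [ggsBFun, ggsBInvFun, h, dif_pos, RelIso.inv_apply_self]
      · simp only [ggsBFun, ggsBInvFun, h, dif_neg, not_false_eq_true, ih]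
  right_inv := by
    intro v
    induction v with
    | nil => rfl
    | cons x w ih =>
      by_cases h : x.val < d - 1
      · simp only [ggsBFun, ggsBInvFun, h, dif_pos, RelIso.apply_inv_self]
      · simp only [ggsBFun, ggsBInvFun, h, dif_neg, not_false_eq_true, ih]
  map_rel_iff' := by
    intro v w
    change IsChild (ggsBFun e v) (ggsBFun e w) ↔ IsChild v w
    induction v generalizing w with
    | nil =>
      cases w with
      | nil => rfl
      | cons y w =>
        have hnil : ∀ (z : Fin d) (t : List (Fin d)), IsChild [] (z :: t) ↔ t = [] := by
          simp [IsChild]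
        by_cases h : y.val < d - 1
        · simp only [ggsBFun, h, dif_pos, hnil]
          rw [← List.length_eq_zero_iff, length_apply, List.length_eq_zero_iff]
        · simp only [ggsBFun, h, dif_neg, not_false_eq_true, hnil]
          cases w with
          | nil => simp [ggsBFun]
          | cons z w =>
            simp only [ggsBFun]
            split <;> simp
    | cons x v ih =>
      cases w with
      | nil => exact iff_of_false (not_isChild_nil _) (not_isChild_nil _)
      | cons y w =>
        by_cases hxy : x = y
        · subst hxy
          by_cases h : x.val < d - 1
          · simp only [ggsBFun, h, dif_pos, isChild_cons_cons, true_and]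
            exact (ggsA d ^ (e ⟨x.val, h⟩).val).map_rel_iff
          · simp only [ggsBFun, h, dif_neg, not_false_eq_true, isChild_cons_cons, true_and, ih]
        · simp only [ggsBFun]
          split <;> split <;> simp [isChild_cons_cons, hxy]

theorem ggsB_mem_levelStabilizer {d : ℕ} (e : Fin (d - 1) → ZMod d) :
    ggsB e ∈ levelStabilizer (Fin d) 1 := by
  intro u hu
  obtain ⟨x, rfl⟩ := List.length_eq_one_iff.mp hu
  change ggsBFun e [x] = [x]
  simp only [ggsBFun]
  split
  · rw [apply_nil]
  · rfl

theorem sectionAt_ggsB_of_lt {d : ℕ} (e : Fin (d - 1) → ZMod d) (x : Fin d)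
    (h : x.val < d - 1) :
    (ggsB e).sectionAt [x] = ggsA d ^ (e ⟨x.val, h⟩).val := by
  ext1 v
  change (ggsBFun e (x :: v)).drop 1 = _
  simp [ggsBFun, h]

theorem sectionAt_ggsB_of_not_lt {d : ℕ} (e : Fin (d - 1) → ZMod d) (x : Fin d)
    (h : ¬ x.val < d - 1) : (ggsB e).sectionAt [x] = ggsB e := by
  ext1 v
  change (ggsBFun e (x :: v)).drop 1 = ggsBFun e v
  simp [ggsBFun, h]

/-- The subgroup generated by `a` and `b`. For `d ≥ 2` and a non-zero vector `e` this is the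
GGS-group with defining vector `e`. -/
def ggsGroup {d : ℕ} (e : Fin (d - 1) → ZMod d) : Subgroup (TreeAut (Fin d)) :=
  Subgroup.closure {ggsA d, ggsB e}

end TreeAut

/-! Induct on `u`, with n its length, carrying two facts (`ggsGroup_le_stabilizerSections`): every
element of G is a section at `u` of an element of st_G(L_n), and some c in st_G(L_{n+1}) has c_u =
b. Conjugating c by elements of st_G(L_n) with section a^k at `u` brings the sections of b to any
child `u ++ [y]`. This gives b and some a^{e_i} with e_i ≠ 0, hence all of G, at that child.

To renew c one level lower, choose g in st_G(L_n) with g_u = ba and take its p-th power. All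
sections of g at L_n lie in G, and p-th powers of elements of G fix L_2 because the e_i sum to zero
(`pow_card_mem_levelStabilizer_two`); so g^p fixes L_{n+2}. The section of (ba)^p at the last letter
is b times a to the power of the sum of the e_i, which is b. A conjugation moves it to y. -/

namespace TreeAut

/-! ### Calculus of sections and level stabilizers -/

section Sections

variable {X : Type*}

theorem sectionAt_eq_of_apply {g s : TreeAut X} {u u' : List X} (hu : u'.length = u.length)
    (h : ∀ v, g (u ++ v) = u' ++ s v) : g.sectionAt u = s := by
  ext1 v
  have hv := h v
  rw [apply_append_sectionAt] at hv
  exact (List.append_inj hv (by rw [length_apply, hu])).2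

theorem sectionAt_nil (g : TreeAut X) : g.sectionAt [] = g :=
  sectionAt_eq_of_apply (u' := []) rfl fun _ => rfl

theorem sectionAt_one (u : List X) : (1 : TreeAut X).sectionAt u = 1 :=
  sectionAt_eq_of_apply (u' := u) rfl fun _ => rfl

theorem sectionAt_mul (g h : TreeAut X) (u : List X) :
    (g * h).sectionAt u = g.sectionAt (h u) * h.sectionAt u :=
  sectionAt_eq_of_apply (u' := g (h u)) (by simp only [length_apply]) fun v => by
    rw [RelIso.mul_apply, apply_append_sectionAt, apply_append_sectionAt, RelIso.mul_apply]

theorem sectionAt_inv (g : TreeAut X) (u : List X) :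
    g⁻¹.sectionAt u = (g.sectionAt (g⁻¹ u))⁻¹ := by
  rw [eq_inv_iff_mul_eq_one]
  have h := sectionAt_mul g⁻¹ g (g⁻¹ u)
  rwa [inv_mul_cancel, sectionAt_one, RelIso.apply_inv_self, eq_comm] at h

theorem sectionAt_append (g : TreeAut X) (u v : List X) :
    g.sectionAt (u ++ v) = (g.sectionAt u).sectionAt v :=
  sectionAt_eq_of_apply (u' := g u ++ g.sectionAt u v) (by simp only [List.length_append,
    length_apply]) fun w => by
    rw [List.append_assoc, apply_append_sectionAt, apply_append_sectionAt, List.append_assoc]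

theorem sectionAt_pow_of_apply_eq {g : TreeAut X} {u : List X} (hu : g u = u) (k : ℕ) :
    (g ^ k).sectionAt u = g.sectionAt u ^ k := by
  induction k with
  | zero => rw [pow_zero, pow_zero, sectionAt_one]
  | succ k ih => rw [pow_succ, sectionAt_mul, hu, ih, pow_succ]

theorem mem_levelStabilizer_add {g : TreeAut X} {n k : ℕ} (hg : g ∈ levelStabilizer X n)
    (h : ∀ u : List X, u.length = n → g.sectionAt u ∈ levelStabilizer X k) :
    g ∈ levelStabilizer X (n + k) := by
  intro u hu
  have hl : (u.take n).length = n := by rw [List.length_take, hu]; omega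
  have hr : (u.drop n).length = k := by rw [List.length_drop, hu]; omega
  conv_lhs => rw [← List.take_append_drop n u]
  rw [apply_append_sectionAt, hg _ hl, h _ hl _ hr, List.take_append_drop]

theorem conj_mem_levelStabilizer {g : TreeAut X} {n : ℕ} (hg : g ∈ levelStabilizer X n)
    (h : TreeAut X) : h * g * h⁻¹ ∈ levelStabilizer X n := by
  intro u hu
  rw [RelIso.mul_apply, RelIso.mul_apply, hg _ (by rw [length_apply, hu]),
    RelIso.apply_inv_self]

theorem sectionAt_conj_of_fixed {g h : TreeAut X} {u : List X} (hg : g u = u) (hh : h u = u) :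
    (h * g * h⁻¹).sectionAt u = h.sectionAt u * g.sectionAt u * (h.sectionAt u)⁻¹ := by
  have hi : h⁻¹ u = u := by
    conv_lhs => rw [← hh]
    exact RelIso.inv_apply_self _ _
  rw [sectionAt_mul, sectionAt_mul, sectionAt_inv, hi, hg]

/-- The image under `g ↦ g_u` of the stabilizer in `G` of the level of `u`. -/
def stabilizerSections (G : Subgroup (TreeAut X)) (u : List X) : Subgroup (TreeAut X) where
  carrier := {s | ∃ g ∈ G, g ∈ levelStabilizer X u.length ∧ g.sectionAt u = s}
  one_mem' := ⟨1, G.one_mem, Subgroup.one_mem _, sectionAt_one u⟩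
  mul_mem' := by
    rintro _ _ ⟨g, hg, hgs, rfl⟩ ⟨h, hh, hhs, rfl⟩
    exact ⟨g * h, G.mul_mem hg hh, Subgroup.mul_mem _ hgs hhs, by
      rw [sectionAt_mul, hhs u rfl]⟩
  inv_mem' := by
    rintro _ ⟨g, hg, hgs, rfl⟩
    exact ⟨g⁻¹, G.inv_mem hg, Subgroup.inv_mem _ hgs, by
      rw [sectionAt_inv, Subgroup.inv_mem _ hgs u rfl]⟩

theorem isSelfSimilar_closure {S : Set (TreeAut X)}
    (h : ∀ s ∈ S, ∀ x : X, s.sectionAt [x] ∈ Subgroup.closure S) :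
    IsSelfSimilar (Subgroup.closure S) := by
  have h1 : ∀ g ∈ Subgroup.closure S, ∀ x : X, g.sectionAt [x] ∈ Subgroup.closure S := by
    intro g hg
    induction hg using Subgroup.closure_induction with
    | mem s hs => exact h s hs
    | one => exact fun x => by rw [sectionAt_one]; exact Subgroup.one_mem _
    | mul f g _ _ hf hg =>
      intro x
      obtain ⟨y, hy⟩ := List.length_eq_one_iff.mp (length_apply g [x])
      rw [sectionAt_mul, hy]
      exact Subgroup.mul_mem _ (hf y) (hg x)
    | inv g _ hg =>
      intro x
      obtain ⟨y, hy⟩ := List.length_eq_one_iff.mp (length_apply g⁻¹ [x])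
      rw [sectionAt_inv, hy]
      exact Subgroup.inv_mem _ (hg y)
  intro g hg u
  induction u generalizing g with
  | nil => rwa [sectionAt_nil]
  | cons x u ih =>
    rw [← List.singleton_append, sectionAt_append]
    exact ih _ (h1 g hg x)

end Sections

/-! ### The rooted generator a -/

section GGS

variable {m : ℕ}

theorem ggsA_apply (x : Fin (m + 1)) (w : List (Fin (m + 1))) :
    ggsA (m + 1) (x :: w) = (x + 1) :: w := by
  rw [← finRotate_apply]
  rfl

theorem ggsA_pow_apply (k : ℕ) (x : Fin (m + 1)) (w : List (Fin (m + 1))) :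
    (ggsA (m + 1) ^ k) (x :: w) = (x + k • 1) :: w := by
  induction k generalizing x with
  | zero => rw [pow_zero, zero_nsmul, add_zero]; rfl
  | succ k ih => rw [pow_succ, RelIso.mul_apply, ggsA_apply, ih, succ_nsmul', add_assoc]

theorem nsmul_one_eq_self (x : Fin (m + 1)) : x.val • (1 : Fin (m + 1)) = x := by
  -- `Fin (m + 1)` and `ZMod (m + 1)` agree definitionally; exponents e_i and translations of
  -- letters are identified this way throughout.
  have h : (ZMod.val (n := m + 1) x) • (1 : ZMod (m + 1)) = x := by
    rw [nsmul_one]; exact ZMod.natCast_zmod_val (n := m + 1) x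
  exact h

theorem nsmul_card_eq_zero (x : Fin (m + 1)) : (m + 1) • x = 0 := by
  simpa using card_nsmul_eq_zero' (G := Fin (m + 1)) (x := x)

theorem ggsA_pow_card : ggsA (m + 1) ^ (m + 1) = 1 := by
  ext1 v
  cases v with
  | nil => rw [apply_nil, apply_nil]
  | cons x w => rw [ggsA_pow_apply, nsmul_card_eq_zero, add_zero]; rfl

theorem sectionAt_ggsA_pow (k : ℕ) (x : Fin (m + 1)) : (ggsA (m + 1) ^ k).sectionAt [x] = 1 :=
  sectionAt_eq_of_apply (u' := [x + k • 1]) rfl fun v => ggsA_pow_apply k x v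

theorem sectionAt_ggsA (x : Fin (m + 1)) : (ggsA (m + 1)).sectionAt [x] = 1 := by
  simpa using sectionAt_ggsA_pow 1 x

/-! ### Translations induced on the first level, and p-th powers -/

/-- The first letter of `g(0)`: an automorphism acting on the first level by a translation
translates by this amount. -/
def firstLevelShift (g : TreeAut (Fin (m + 1))) : Fin (m + 1) := (g [0]).headD 0

theorem firstLevelShift_eq {g : TreeAut (Fin (m + 1))} {r : Fin (m + 1)}
    (h : ∀ x, g [x] = [x + r]) : firstLevelShift g = r := by
  rw [firstLevelShift, h, zero_add, List.headD_cons]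

variable (e : Fin (m + 1 - 1) → ZMod (m + 1))

theorem ggsA_mem : ggsA (m + 1) ∈ ggsGroup e := Subgroup.subset_closure (Or.inl rfl)

theorem ggsB_mem : ggsB e ∈ ggsGroup e := Subgroup.subset_closure (Or.inr rfl)

theorem ggsB_apply_singleton (x : Fin (m + 1)) : ggsB e [x] = [x] :=
  ggsB_mem_levelStabilizer e [x] rfl

theorem isSelfSimilar_ggsGroup : IsSelfSimilar (ggsGroup e) := by
  refine isSelfSimilar_closure ?_
  rintro s (rfl | rfl) x
  · rw [sectionAt_ggsA]; exact Subgroup.one_mem _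
  · by_cases h : x.val < m + 1 - 1
    · rw [sectionAt_ggsB_of_lt e x h]; exact Subgroup.pow_mem _ (ggsA_mem e) _
    · rw [sectionAt_ggsB_of_not_lt e x h]; exact ggsB_mem e

variable {e}

theorem apply_singleton_of_mem {g : TreeAut (Fin (m + 1))} (hg : g ∈ ggsGroup e)
    (x : Fin (m + 1)) : g [x] = [x + firstLevelShift g] := by
  suffices h : ∃ r, ∀ x, g [x] = [x + r] by
    obtain ⟨r, hr⟩ := h
    rw [firstLevelShift_eq hr, hr]
  clear x
  induction hg using Subgroup.closure_induction with
  | mem s hs =>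
    rcases hs with rfl | rfl
    · exact ⟨1, fun x => ggsA_apply x []⟩
    · exact ⟨0, fun x => by rw [ggsB_apply_singleton, add_zero]⟩
  | one => exact ⟨0, fun x => by rw [add_zero]; rfl⟩
  | mul f g _ _ hf hg =>
    obtain ⟨r, hr⟩ := hf
    obtain ⟨s, hs⟩ := hg
    exact ⟨s + r, fun x => by rw [RelIso.mul_apply, hs, hr, add_assoc]⟩
  | inv g _ hg =>
    obtain ⟨r, hr⟩ := hg
    refine ⟨-r, fun x => g.injective ?_⟩
    rw [RelIso.apply_inv_self, hr, neg_add_cancel_right]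

theorem firstLevelShift_mul {f g : TreeAut (Fin (m + 1))} (hf : f ∈ ggsGroup e)
    (hg : g ∈ ggsGroup e) : firstLevelShift (f * g) = firstLevelShift f + firstLevelShift g :=
  firstLevelShift_eq fun x => by
    rw [RelIso.mul_apply, apply_singleton_of_mem hg, apply_singleton_of_mem hf, add_assoc,
      add_comm (firstLevelShift g)]

theorem firstLevelShift_one : firstLevelShift (1 : TreeAut (Fin (m + 1))) = 0 := rfl

theorem firstLevelShift_pow {g : TreeAut (Fin (m + 1))} (hg : g ∈ ggsGroup e) (k : ℕ) :
    firstLevelShift (g ^ k) = k • firstLevelShift g := by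
  induction k with
  | zero => rw [pow_zero, zero_nsmul, firstLevelShift_one]
  | succ k ih => rw [pow_succ, firstLevelShift_mul (Subgroup.pow_mem _ hg k) hg, ih, succ_nsmul]

theorem firstLevelShift_sectionAt_mul {f g : TreeAut (Fin (m + 1))} (hf : f ∈ ggsGroup e)
    (hg : g ∈ ggsGroup e) (x : Fin (m + 1)) :
    firstLevelShift ((f * g).sectionAt [x]) =
      firstLevelShift (f.sectionAt [x + firstLevelShift g]) +
        firstLevelShift (g.sectionAt [x]) := by
  rw [sectionAt_mul, apply_singleton_of_mem hg]
  exact firstLevelShift_mul (isSelfSimilar_ggsGroup e _ hf _) (isSelfSimilar_ggsGroup e _ hg _)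

/-- The sections of f occur at translated letters, and a translation only permutes the summands. So
the total shift is a homomorphism on G. -/
theorem sum_firstLevelShift_mul {f g : TreeAut (Fin (m + 1))} (hf : f ∈ ggsGroup e)
    (hg : g ∈ ggsGroup e) :
    ∑ x, firstLevelShift ((f * g).sectionAt [x]) =
      ∑ x, firstLevelShift (f.sectionAt [x]) + ∑ x, firstLevelShift (g.sectionAt [x]) := by
  simp_rw [firstLevelShift_sectionAt_mul hf hg]
  rw [Finset.sum_add_distrib]
  congr 1
  exact Equiv.sum_comp (Equiv.addRight (firstLevelShift g))
    fun x => firstLevelShift (f.sectionAt [x])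

theorem sum_firstLevelShift_ggsB :
    ∑ x, firstLevelShift ((ggsB e).sectionAt [x]) = ∑ i, e i := by
  rw [Fin.sum_univ_castSucc, sectionAt_ggsB_of_not_lt e _ (by simp),
    firstLevelShift_eq (r := 0) (fun x => by rw [ggsB_apply_singleton, add_zero]), add_zero]
  refine Finset.sum_congr rfl fun i _ => ?_
  rw [sectionAt_ggsB_of_lt e i.castSucc (by simp), firstLevelShift_eq (ggsA_pow_apply _ · [])]
  exact nsmul_one_eq_self _

theorem sum_firstLevelShift_eq_zero (hsum : ∑ i, e i = 0) {g : TreeAut (Fin (m + 1))}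
    (hg : g ∈ ggsGroup e) : ∑ x, firstLevelShift (g.sectionAt [x]) = 0 := by
  have h1 : ∑ x : Fin (m + 1), firstLevelShift ((1 : TreeAut (Fin (m + 1))).sectionAt [x]) = 0 :=
    Finset.sum_eq_zero fun x _ => by rw [sectionAt_one, firstLevelShift_one]
  induction hg using Subgroup.closure_induction with
  | mem s hs =>
    rcases hs with rfl | rfl
    · exact Finset.sum_eq_zero fun x _ => by rw [sectionAt_ggsA, firstLevelShift_one]
    · exact sum_firstLevelShift_ggsB.trans hsum
  | one => exact h1
  | mul f g hf hg ihf ihg => rw [sum_firstLevelShift_mul hf hg, ihf, ihg, add_zero]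
  | inv g hg ih =>
    have h := sum_firstLevelShift_mul hg (Subgroup.inv_mem _ hg)
    rwa [mul_inv_cancel, h1, ih, zero_add, eq_comm] at h

/-- The section of a power is the product of the sections of g along the orbit of x, and shifts are
additive. -/
theorem firstLevelShift_sectionAt_pow {g : TreeAut (Fin (m + 1))} (hg : g ∈ ggsGroup e)
    (x : Fin (m + 1)) (k : ℕ) :
    firstLevelShift ((g ^ k).sectionAt [x]) =
      ∑ i ∈ Finset.range k, firstLevelShift (g.sectionAt [x + i • firstLevelShift g]) := by
  induction k with
  | zero => rw [pow_zero, sectionAt_one, firstLevelShift_one, Finset.sum_range_zero]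
  | succ k ih =>
    rw [pow_succ', firstLevelShift_sectionAt_mul hg (Subgroup.pow_mem _ hg k), ih,
      firstLevelShift_pow hg, Finset.sum_range_succ]
    exact add_comm _ _

theorem bijective_add_nsmul (hp : (m + 1).Prime) (x : Fin (m + 1)) {r : Fin (m + 1)}
    (hr : r ≠ 0) : Function.Bijective fun i : Fin (m + 1) => x + i.val • r := by
  refine (Equiv.addLeft x).bijective.comp (Finite.injective_iff_bijective.mp ?_)
  have : Fact (m + 1).Prime := ⟨hp⟩
  have ho : addOrderOf r = m + 1 := addOrderOf_eq_prime (nsmul_card_eq_zero r) hr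
  exact fun i j hij => Fin.ext (nsmul_injOn_Iio_addOrderOf (i.isLt.trans_eq ho.symm)
    (j.isLt.trans_eq ho.symm) hij)

theorem pow_card_mem_levelStabilizer_two (hp : (m + 1).Prime) (hsum : ∑ i, e i = 0)
    {g : TreeAut (Fin (m + 1))} (hg : g ∈ ggsGroup e) :
    g ^ (m + 1) ∈ levelStabilizer (Fin (m + 1)) 2 := by
  have hgp := Subgroup.pow_mem _ hg (m + 1)
  refine mem_levelStabilizer_add (n := 1) (k := 1) ?_ ?_
  · intro u hu
    obtain ⟨x, rfl⟩ := List.length_eq_one_iff.mp hu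
    rw [apply_singleton_of_mem hgp, firstLevelShift_pow hg, nsmul_card_eq_zero, add_zero]
  · intro u hu v hv
    obtain ⟨x, rfl⟩ := List.length_eq_one_iff.mp hu
    obtain ⟨y, rfl⟩ := List.length_eq_one_iff.mp hv
    rw [apply_singleton_of_mem (isSelfSimilar_ggsGroup e _ hgp _),
      firstLevelShift_sectionAt_pow hg]
    suffices h : ∑ i ∈ Finset.range (m + 1),
        firstLevelShift (g.sectionAt [x + i • firstLevelShift g]) = 0 by rw [h, add_zero]
    by_cases hr : firstLevelShift g = 0
    -- The orbit is a single letter: p equal summands cancel.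
    · simp only [hr, nsmul_zero, add_zero, Finset.sum_const, Finset.card_range,
        nsmul_card_eq_zero]
    -- As p is prime, the orbit runs once through all letters and yields the total shift, which
    -- vanishes on G.
    · rw [Finset.sum_range, ← sum_firstLevelShift_eq_zero hsum hg]
      exact (bijective_add_nsmul hp x hr).sum_comp fun y => firstLevelShift (g.sectionAt [y])

/-! ### The p-th power of ba -/

theorem ggsB_mul_ggsA_pow_apply_last (k : ℕ) :
    ((ggsB e * ggsA (m + 1)) ^ k) [Fin.last m] = [Fin.last m + k • 1] := by
  induction k with
  | zero => rw [pow_zero, zero_nsmul, add_zero]; rfl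
  | succ k ih =>
    rw [pow_succ', RelIso.mul_apply, ih, RelIso.mul_apply, ggsA_apply, ggsB_apply_singleton,
      succ_nsmul, add_assoc]

theorem sectionAt_ggsB_mul_ggsA_pow_succ_last (k : ℕ) :
    ((ggsB e * ggsA (m + 1)) ^ (k + 1)).sectionAt [Fin.last m] =
      (ggsB e).sectionAt [k • 1] *
        ((ggsB e * ggsA (m + 1)) ^ k).sectionAt [Fin.last m] := by
  have h : Fin.last m + k • (1 : Fin (m + 1)) + 1 = k • 1 := by
    rw [add_right_comm, Fin.last_add_one, zero_add]
  rw [pow_succ', sectionAt_mul, ggsB_mul_ggsA_pow_apply_last, sectionAt_mul, sectionAt_ggsA,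
    mul_one, ggsA_apply, h]

/-- The bound on k keeps the orbit short of the factor contributed by b at the last letter, so only
commuting powers of a are multiplied. -/
theorem sectionAt_ggsB_mul_ggsA_pow_last (k : ℕ) (hk : k ≤ m) :
    ((ggsB e * ggsA (m + 1)) ^ k).sectionAt [Fin.last m] =
      ggsA (m + 1) ^ (∑ i : Fin k, (e (i.castLE hk)).val) := by
  induction k with
  | zero => rw [pow_zero, sectionAt_one, Fin.sum_univ_zero, pow_zero]
  | succ k ih =>
    have hk' : (k • (1 : Fin (m + 1))) = ⟨k, by omega⟩ := nsmul_one_eq_self ⟨k, by omega⟩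
    rw [sectionAt_ggsB_mul_ggsA_pow_succ_last, ih (by omega), hk',
      sectionAt_ggsB_of_lt e ⟨k, _⟩ (Nat.lt_of_succ_le hk), Fin.sum_univ_castSucc, pow_add]
    exact (Commute.refl _).pow_pow _ _

theorem ggsA_pow_sum_eq_one (hsum : ∑ i, e i = 0) : ggsA (m + 1) ^ (∑ i, (e i).val) = 1 := by
  have h : ((∑ i, (e i).val : ℕ) : ZMod (m + 1)) = 0 := by
    rw [Nat.cast_sum, ← hsum]
    exact Finset.sum_congr rfl fun i _ => ZMod.natCast_zmod_val _
  obtain ⟨c, hc⟩ := (ZMod.natCast_eq_zero_iff _ _).mp h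
  rw [hc, pow_mul, ggsA_pow_card, one_pow]

theorem sectionAt_ggsB_mul_ggsA_pow_card_last (hsum : ∑ i, e i = 0) :
    ((ggsB e * ggsA (m + 1)) ^ (m + 1)).sectionAt [Fin.last m] = ggsB e := by
  have hm : (m • (1 : Fin (m + 1))) = Fin.last m := nsmul_one_eq_self (Fin.last m)
  rw [sectionAt_ggsB_mul_ggsA_pow_succ_last, sectionAt_ggsB_mul_ggsA_pow_last m le_rfl, hm,
    sectionAt_ggsB_of_not_lt e _ (by simp)]
  exact (congrArg (ggsB e * ·) (ggsA_pow_sum_eq_one hsum)).trans (mul_one _)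

/-! ### Moving sections between siblings, and the induction -/

theorem sectionAt_conj_ggsA_pow (g : TreeAut (Fin (m + 1))) (x y : Fin (m + 1)) :
    (ggsA (m + 1) ^ (y - x).val * g * (ggsA (m + 1) ^ (y - x).val)⁻¹).sectionAt [y] =
      g.sectionAt [x] := by
  have hi : (ggsA (m + 1) ^ (y - x).val)⁻¹ [y] = [x] := by
    apply (ggsA (m + 1) ^ (y - x).val).injective
    rw [RelIso.apply_inv_self, ggsA_pow_apply, nsmul_one_eq_self, add_sub_cancel]
  obtain ⟨z, hz⟩ := List.length_eq_one_iff.mp (length_apply g [x])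
  rw [sectionAt_mul, sectionAt_mul, sectionAt_inv, hi, sectionAt_ggsA_pow, inv_one, mul_one, hz,
    sectionAt_ggsA_pow, one_mul]

theorem apply_eq_self_of_mem_levelStabilizer {g : TreeAut (Fin (m + 1))} {k : ℕ}
    (hg : g ∈ levelStabilizer (Fin (m + 1)) k) {u : List (Fin (m + 1))} (hu : u.length ≤ k) :
    g u = u := by
  -- Any extension of `u` to length k would do; the letter 0 is arbitrary.
  have h := hg (u ++ List.replicate (k - u.length) 0) (by simp; omega)
  rw [apply_append_sectionAt] at h
  exact (List.append_inj h (length_apply g u)).1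

/-- If all elements of the group are sections at `u` of elements stabilizing the level of `u`,
then a first-level section of `c_u`, where `c` stabilizes a level below `u`, occurs at every
child of `u`. -/
theorem exists_sectionAt_append_singleton {u : List (Fin (m + 1))} {k : ℕ} (hk : u.length ≤ k)
    (hP : ggsGroup e ≤ stabilizerSections (ggsGroup e) u) {c : TreeAut (Fin (m + 1))}
    (hc : c ∈ ggsGroup e) (hck : c ∈ levelStabilizer (Fin (m + 1)) k)
    (x y : Fin (m + 1)) :
    ∃ d ∈ ggsGroup e, d ∈ levelStabilizer (Fin (m + 1)) k ∧
      d.sectionAt (u ++ [y]) = (c.sectionAt u).sectionAt [x] := by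
  obtain ⟨h, hh, hhs, hhu⟩ := hP (Subgroup.pow_mem _ (ggsA_mem e) (y - x).val)
  refine ⟨h * c * h⁻¹, Subgroup.mul_mem _ (Subgroup.mul_mem _ hh hc) (Subgroup.inv_mem _ hh),
    conj_mem_levelStabilizer hck h, ?_⟩
  rw [sectionAt_append, sectionAt_conj_of_fixed
    (apply_eq_self_of_mem_levelStabilizer hck hk) (hhs u rfl), hhu, sectionAt_conj_ggsA_pow]

/-- A non-zero e_i is prime to p and a^p = 1, so a is a power of a^{e_i}. -/
theorem ggsGroup_le_of_pow_mem (hp : (m + 1).Prime) {H : Subgroup (TreeAut (Fin (m + 1)))}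
    {i : Fin (m + 1 - 1)} (hi : e i ≠ 0) (ha : ggsA (m + 1) ^ (e i).val ∈ H)
    (hb : ggsB e ∈ H) : ggsGroup e ≤ H := by
  refine (Subgroup.closure_le H).mpr ?_
  rintro s (rfl | rfl)
  · have : Fact (m + 1).Prime := ⟨hp⟩
    have hco : ((e i).val).Coprime (m + 1) := by
      refine (Nat.Coprime.symm ((Nat.Prime.coprime_iff_not_dvd hp).mpr fun h => hi ?_))
      rw [← ZMod.natCast_zmod_val (e i)]
      exact (ZMod.natCast_eq_zero_iff _ _).mpr h
    obtain ⟨k, hk⟩ := exists_pow_eq_self_of_coprime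
      (hco.coprime_dvd_right (orderOf_dvd_of_pow_eq_one (ggsA_pow_card (m := m))))
    rw [SetLike.mem_coe, ← hk]
    exact H.pow_mem ha k
  · exact hb

theorem ggsGroup_le_stabilizerSections (hp : (m + 1).Prime) (he : e ≠ 0) (hsum : ∑ i, e i = 0)
    (u : List (Fin (m + 1))) :
    ggsGroup e ≤ stabilizerSections (ggsGroup e) u ∧
      ∃ c ∈ ggsGroup e, c ∈ levelStabilizer (Fin (m + 1)) (u.length + 1) ∧
        c.sectionAt u = ggsB e := by
  obtain ⟨i, hi⟩ := Function.ne_iff.mp he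
  induction u using List.reverseRecOn with
  | nil =>
    refine ⟨fun g hg => ⟨g, hg, ?_, sectionAt_nil g⟩, ggsB e, ggsB_mem e,
      ggsB_mem_levelStabilizer e, sectionAt_nil _⟩
    intro v hv
    rw [List.length_eq_zero_iff.mp hv, apply_nil]
  | append_singleton u y ih =>
    obtain ⟨hP, c, hc, hcs, hcb⟩ := ih
    have hlen : (u ++ [y]).length = u.length + 1 := by simp
    constructor
    · obtain ⟨f, hf, hfs, hfu⟩ :=
        exists_sectionAt_append_singleton (Nat.le_succ _) hP hc hcs (Fin.last m) y
      obtain ⟨g, hg, hgs, hgu⟩ :=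
        exists_sectionAt_append_singleton (Nat.le_succ _) hP hc hcs (i.castLT (by omega)) y
      rw [hcb, sectionAt_ggsB_of_not_lt e _ (by simp)] at hfu
      rw [hcb, sectionAt_ggsB_of_lt e _ (by simp)] at hgu
      exact ggsGroup_le_of_pow_mem hp hi ⟨g, hg, by rwa [hlen], hgu⟩ ⟨f, hf, by rwa [hlen], hfu⟩
    · obtain ⟨g, hg, hgs, hgu⟩ := hP (Subgroup.mul_mem _ (ggsB_mem e) (ggsA_mem e))
      have hgps := Subgroup.pow_mem _ hgs (m + 1)
      have hst : g ^ (m + 1) ∈ levelStabilizer (Fin (m + 1)) (u.length + 2) := by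
        -- Away from `u` nothing is known of the sections of g except that they lie in G, which
        -- suffices for their p-th powers to fix two more levels.
        refine mem_levelStabilizer_add hgps fun v hv => ?_
        rw [sectionAt_pow_of_apply_eq (hgs v hv)]
        exact pow_card_mem_levelStabilizer_two hp hsum (isSelfSimilar_ggsGroup e g hg v)
      obtain ⟨d, hd, hds, hdu⟩ := exists_sectionAt_append_singleton (Nat.le_add_right _ _) hP
        (Subgroup.pow_mem _ hg (m + 1)) hst (Fin.last m) y
      rw [sectionAt_pow_of_apply_eq (hgs u rfl), hgu,
        sectionAt_ggsB_mul_ggsA_pow_card_last hsum] at hdu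
      exact ⟨d, hd, by rwa [hlen], hdu⟩

end GGS

end TreeAut

theorem mainTheorem3 (p : ℕ) (hp : p.Prime) (e : Fin (p - 1) → ZMod p) (he : e ≠ 0)
    (hsum : ∑ i, e i = 0) :
    TreeAut.IsSuperStronglyFractal (TreeAut.ggsGroup e) := by
  -- Writing p = m + 1 makes the additive group structure on the letters available.
  obtain ⟨m, rfl⟩ := Nat.exists_eq_succ_of_ne_zero hp.ne_zero
  refine ⟨TreeAut.isSelfSimilar_ggsGroup e, ?_⟩
  rintro _ u rfl
  refine Set.Subset.antisymm ?_ fun g hg => ?_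
  · rintro _ ⟨g, hg, rfl⟩
    exact TreeAut.isSelfSimilar_ggsGroup e g hg.1 u
  · obtain ⟨h, hh, hs, rfl⟩ := (TreeAut.ggsGroup_le_stabilizerSections hp he hsum u).1 hg
    exact ⟨h, ⟨hh, hs⟩, rfl⟩
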